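/- **Lemma 3.1.** Construct a graph $\Psi$ as follows. *The graph $H_2$.* Let $T_3$ be the infinite tree with a root $r$ of degree $3$ and all other vertices of degree $4$. For each $n\ge 1$ put a cycle of length $3^n$ on the vertices at distance $n$ from $r$, in the planar way: the vertices at distance $n$ from $r$ are $(n,j)$, $0\le j<3^n$, the outer neighbours of $(n,j)$ in $T_3$ are $(n+1,3j),(n+1,3j+1),(n+1,3j+2)$, and for $n\ge1$ we join $(n,j)$ to $(n,j+1 \bmod 3^n)$. The height of a vertex is its distance from $r$. *The graph $W$.* Its vertices are $r_i^k$, $i\in\{0,1,2,\dots\}$, $k\in\mathbb Z$, and its edges are $r_i^kr_i^{k+1}$ and $r_i^kr_{i+1}^{2k}$. The height of $r_i^k$ is $i$. *The graph $H_3$.* Its vertices are the pairs $(t,w)$ of vertices $t$ of $H_2$ and $w$ of $W$ of equal height; $(t,w)$ and $(t',w')$ are adjacent if $tt'\in E(H_2)$ and $ww'\in E(W)$, or $tt'\in E(H_2)$ and $w=w'$, or $t=t'$ and $ww'\in E(W)$. *The meatballs.* For $n\ge1$ let $M_n$ be the subgraph of $H_3$ induced by the vertices $(t,r_i^k)$ with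 $i\le n$ and $0\le k/2^i\le 3\cdot 2^n$. Its bottom path consists of the vertices $r(x)=(r,r_0^x)$, $0\le x\le 3\cdot2^n$. Put $L_n=\{r(x): 0\le x<2^n\}$ and $R_n=\{r(x): 2^n<x\le 3\cdot 2^n\}$. *The graph $\Psi$.* Let $S=s_0s_1s_2\dots$ be a one-way infinite path (the skewer). Glue the bottom path of $M_1$ onto the initial segment of $S$, and, for $n=2,3,\dots$, glue the bottom path of $M_n$, in the order of $S$, onto the segment of $S$ for which $L_n$ is identified with $R_{n-1}$. Explicitly, $r(x)$ in $M_n$ is identified with $s_{a_n+x}$, where $a_1=0$ and $a_{n+1}=a_n+2^n+1$. The resulting graph is $\Psi$. Then $\Psi$ is (connected and) Gromov-hyperbolic, that is, there is a $\delta$ such that the Gromov products $(x\mid y)_w=\frac12\big(d(x,w)+d(y,w)-d(x,y)\big)$ of its graph metric satisfy $(x\mid z)_w\ge\min\{(x\mid y)_w,(y\mid z)_w\}-\delta$ for all vertices $x,y,z,w$; and its hyperbolic boundary (the set of infinite geodesics up to bounded distance) consists of exactly one point. Moreover, from every vertex of $\Psi$ there is an infinite geodesic; any two infinite geodesics $\gamma,\gamma'$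 from the same vertex satisfy $\gamma(i)=\gamma'(i)$ for all large $i$; and every infinite geodesic eventually coincides with the skewer, i.e. it has a tail of the form $s_a,s_{a+1},s_{a+2},\dots$ -/

import Mathlib

namespace Souvlaki

section General

variable {V : Type*}

/-- The Gromov product `(x | y)_w` of vertices of a graph, with respect to the graph metric. -/
noncomputable def gromovProduct (G : SimpleGraph V) (x y w : V) : ℝ :=
  ((G.dist x w : ℝ) + (G.dist y w : ℝ) - (G.dist x y : ℝ)) / 2

/-- A graph is Gromov-hyperbolic if it is connected (so that `G.dist` is a metric) and its graph
metric satisfies `(x | z)_w ≥ min {(x | y)_w, (y | z)_w} - δ` for some constant `δ`. -/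
def IsGromovHyperbolic (G : SimpleGraph V) : Prop :=
  G.Connected ∧ ∃ δ : ℝ, ∀ x y z w : V,
    min (gromovProduct G x y w) (gromovProduct G y z w) - δ ≤ gromovProduct G x z w

/-- An infinite geodesic (geodesic ray) `γ 0, γ 1, γ 2, …`: the distance between `γ i` and
`γ (i + j)` is exactly `j`. In particular consecutive vertices are adjacent. -/
def IsGeodesicRay (G : SimpleGraph V) (γ : ℕ → V) : Prop :=
  ∀ i j : ℕ, G.dist (γ i) (γ (i + j)) = j

/-- Two geodesic rays are equivalent if they stay at bounded distance from each other. -/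
def rayEquiv (G : SimpleGraph V) : Setoid {γ : ℕ → V // IsGeodesicRay G γ} where
  r γ γ' := ∃ C : ℕ, ∀ i : ℕ, G.edist (γ.1 i) (γ'.1 i) ≤ C
  iseqv :=
    { refl := fun γ => ⟨0, fun i => by simp⟩
      symm := fun {γ γ'} ⟨C, h⟩ => ⟨C, fun i => by rw [SimpleGraph.edist_comm]; exact h i⟩
      trans := fun {γ₁ γ₂ γ₃} ⟨C, h⟩ ⟨D, k⟩ => ⟨C + D, fun i => by
        push_cast
        exact SimpleGraph.edist_triangle.trans (add_le_add (h i) (k i))⟩ }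

/-- The hyperbolic (Gromov) boundary: geodesic rays, from arbitrary starting vertices, modulo
bounded distance. -/
def HyperbolicBoundary (G : SimpleGraph V) : Type _ :=
  Quotient (rayEquiv G)

end General

/-- Vertices of `T₃`: the `3 ^ n` vertices at distance `n` from the root are `(n, 0), …,
(n, 3 ^ n - 1)`, listed in their cyclic order. -/
abbrev TVert : Type := Σ n : ℕ, Fin (3 ^ n)

/-- The tree `T₃`, whose root has degree 3 and whose other vertices have degree 4: the outer
neighbours of `(n, j)` are `(n + 1, 3 j)`, `(n + 1, 3 j + 1)`, `(n + 1, 3 j + 2)`. -/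
def T3 : SimpleGraph TVert :=
  SimpleGraph.fromRel fun u v => v.1 = u.1 + 1 ∧ v.2.val / 3 = u.2.val

/-- The cycles of length `3 ^ n` on the levels `n ≥ 1` of `T₃`
(`fromRel` discards the loop at level `0`). -/
def levelCycles : SimpleGraph TVert :=
  SimpleGraph.fromRel fun u v => v.1 = u.1 ∧ v.2.val = (u.2.val + 1) % 3 ^ u.1

/-- The graph `H₂`: the tree `T₃` together with the level cycles. -/
def H2 : SimpleGraph TVert := T3 ⊔ levelCycles

/-- Vertices of `W`: the pair `(i, k)` is the vertex `r_i^k` of the double ray `D_i`. -/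
abbrev WVert : Type := ℕ × ℤ

/-- The graph `W`: edges `r_i^k r_i^{k+1}` of the double rays, and edges `r_i^k r_{i+1}^{2k}`. -/
def W : SimpleGraph WVert :=
  SimpleGraph.fromRel fun u v =>
    (v.1 = u.1 ∧ v.2 = u.2 + 1) ∨ (v.1 = u.1 + 1 ∧ v.2 = 2 * u.2)

/-- Vertices of `H₃`: pairs `(t, w)` of vertices of `H₂` and `W` of equal height. The height of
`t` is its distance from the root, the height of `w` is the index of its double ray. -/
abbrev H3Vert : Type := {p : TVert × WVert // p.1.1 = p.2.1}

/-- The common height of the two coordinates of a vertex of `H₃`. -/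
def height (v : H3Vert) : ℕ := v.1.2.1

/-- The graph `H₃`. -/
def H3 : SimpleGraph H3Vert where
  Adj u v :=
    (H2.Adj u.1.1 v.1.1 ∧ W.Adj u.1.2 v.1.2) ∨
    (H2.Adj u.1.1 v.1.1 ∧ u.1.2 = v.1.2) ∨
    (u.1.1 = v.1.1 ∧ W.Adj u.1.2 v.1.2)
  symm := ⟨fun _ _ h => h.elim
    (fun h => Or.inl ⟨h.1.symm, h.2.symm⟩)
    (fun h => Or.inr (h.elim (fun h => Or.inl ⟨h.1.symm, h.2.symm⟩)
      (fun h => Or.inr ⟨h.1.symm, h.2.symm⟩)))⟩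
  loopless := ⟨fun _ h => h.elim (fun h => h.1.ne rfl)
    (fun h => h.elim (fun h => h.1.ne rfl) (fun h => h.2.ne rfl))⟩

/-- The box `B_n ⊆ W`: the vertices `r_i^k` of height `i ≤ n` that lie in or above the path
`P_n = r_0^0 … r_0^{3·2^n}`. Drawn in the plane, `r_i^k` has horizontal coordinate `k / 2^i`. -/
def box (n : ℕ) : Set WVert :=
  {w | w.1 ≤ n ∧ 0 ≤ w.2 ∧ w.2 ≤ 3 * 2 ^ n * 2 ^ w.1}

/-- The vertex set of the meatball `M_n`; the meatball is the subgraph of `H₃` induced by it. -/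
def meatball (n : ℕ) : Set H3Vert := {v | v.1.2 ∈ box n}

/-- `glueStart n` is the position on the skewer of the first vertex `r(0)` of the bottom path of
`M_n`, `n ≥ 1`. The path of `M_1` starts at the root of the skewer; the path of `M_{n+1}` starts at
the first vertex `r(2^n + 1)` of the last part `R_n = {r(x) | 2^n < x ≤ 3·2^n}` of the path
of `M_n`, so that the first `2^(n+1)` vertices of the path of `M_{n+1}` are glued onto `R_n`.
(The value at `0` is irrelevant.) -/
def glueStart : ℕ → ℕ
  | 0 => 0
  | 1 => 0
  | n + 2 => glueStart (n + 1) + (2 ^ (n + 1) + 1)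

/-- The vertices of `Ψ`: the vertices `s_0, s_1, …` of the skewer, and the vertices of the
meatballs `M_n`, `n ≥ 1`, that do not lie on the bottom path (i.e. have positive height). -/
inductive PsiVert : Type
  | skewer (i : ℕ) : PsiVert
  | inner (n : ℕ) (v : H3Vert) (hn : 1 ≤ n) (hv : v ∈ meatball n) (hpos : 0 < height v) : PsiVert

/-- The inclusion of `M_n` into `Ψ`: the vertex `r(x)` of the bottom path is identified with the
vertex `s_{glueStart n + x}` of the skewer, the other vertices are kept. -/
def glue (n : ℕ) (hn : 1 ≤ n) (v : H3Vert) (hv : v ∈ meatball n) : PsiVert :=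
  if h : 0 < height v then PsiVert.inner n v hn hv h
  else PsiVert.skewer (glueStart n + v.1.2.2.toNat)

/-- The hyperbolic souvlaki `Ψ`: the union of the ray `s_0 s_1 …` and of the images of all
meatballs `M_n`, `n ≥ 1`. -/
def Psi : SimpleGraph PsiVert :=
  SimpleGraph.fromRel fun p q =>
    (∃ i : ℕ, p = PsiVert.skewer i ∧ q = PsiVert.skewer (i + 1)) ∨
    (∃ (n : ℕ) (hn : 1 ≤ n) (u v : H3Vert) (hu : u ∈ meatball n) (hv : v ∈ meatball n),
      H3.Adj u v ∧ p = glue n hn u hu ∧ q = glue n hn v hv)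

end Souvlaki

/-! `Psi` is a stack of levels over the skewer. Passing to the parent in the tree and halving the
`W`-coordinate projects each level to the next lower one. This moves a vertex by at most 2 and maps
a horizontal path of length `b` to one of length at most `(b + 1) / 2` (`HNear.proj`). As in a
horoball, long horizontal stretches are therefore shortened by descending: up to an additive
constant, a geodesic descends from both ends and joins the projections by a horizontal path, which
is short unless it lies on the skewer (`exists_level_hnear`, `exists_level_close`). So the Gromov
product based at `s 0` is determined, up to a constant, by a level at which two vertices have close
projections or, if that level is 0, by the smaller of their positions on the skewer. Comparing these
levels for three vertices gives hyperbolicity.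

The position `⌊k / 2^i⌋` along the skewer is 1-Lipschitz and invariant under projection. Hence the
skewer is geodesic, and a geodesic ray that runs outwards between two skewer vertices cannot leave
it in between, since vertical edges gain no position. Each meatball is bounded, and the interiors of
different meatballs are not joined by edges, so a geodesic ray returns to the skewer again and again
and finally runs along it (`exists_tail`). The statements on rays and boundary follow. The offsets
at which the meatballs are glued play no role. -/

namespace Souvlaki

/-! ### Four-point condition, layered graphs and horizontal paths -/

section Hyperbolicity

variable {V : Type*} {G : SimpleGraph V}

/-- The three-point condition at one base point implies hyperbolicity. -/
theorem isGromovHyperbolic_of_basePoint (hG : G.Connected) (o : V) (δ : ℝ)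
    (h : ∀ x y z : V,
      min (gromovProduct G x y o) (gromovProduct G y z o) - δ ≤ gromovProduct G x z o) :
    IsGromovHyperbolic G := by
  -- The four instances run around the cycle `x, y, z, w`. A bound for `(x | z)_o` plus one for `(y
  -- | w)_o` yields the four-point inequality with error `2 * δ`, in which the distances to `o`
  -- cancel.
  refine ⟨hG, 2 * δ, fun x y z w => ?_⟩
  have h1 := h x y z
  have h2 := h x w z
  have h3 := h y x w
  have h4 := h y z w
  simp only [gromovProduct, sub_le_iff_le_add, min_le_iff, G.dist_comm (u := y) (v := x),
    G.dist_comm (u := w) (v := z)] at h1 h2 h3 h4 ⊢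
  rcases h1 with h1 | h1 <;> rcases h2 with h2 | h2 <;> rcases h3 with h3 | h3 <;>
    rcases h4 with h4 | h4 <;>
    first
    | (left; linarith)
    | (right; linarith)
    | (by_contra hc
       push Not at hc
       linarith [hc.1, hc.2])

/-- Data exhibiting a graph as a stack of levels: every edge is horizontal, or joins a vertex to
its projection one level down; every vertex is within distance two of its projection, and the
projection shortens horizontal paths. -/
structure IsLayered (G : SimpleGraph V) (ht : V → ℕ) (π : V → V) : Prop where
  ht_proj : ∀ v, ht (π v) = ht v - 1
  adj_cases : ∀ u v, G.Adj u v →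
    ht u = ht v ∨ (ht u = ht v + 1 ∧ π u = v) ∨ (ht v = ht u + 1 ∧ π v = u)
  near_proj : ∀ v, ∃ w, (v = w ∨ G.Adj v w) ∧ (w = π v ∨ G.Adj w (π v))
  contract : ∀ u w v, 0 < ht u → ht u = ht w → ht w = ht v → (u = w ∨ G.Adj u w) →
    (w = v ∨ G.Adj w v) → (π u = π v ∨ G.Adj (π u) (π v))

/-- `HNear G ht b u v` if `u` and `v` are joined by a horizontal path of length at most `b`. -/
def HNear (G : SimpleGraph V) (ht : V → ℕ) : ℕ → V → V → Prop
  | 0, u, v => u = v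
  | b + 1, u, v => ∃ w, HNear G ht b u w ∧ ht w = ht v ∧ (w = v ∨ G.Adj w v)

/-- The projection of a vertex to level `j`. -/
def level (ht : V → ℕ) (π : V → V) (j : ℕ) (v : V) : V := π^[ht v - j] v

variable {ht : V → ℕ} {π : V → V}

namespace HNear

variable {a b : ℕ} {u v w : V}

theorem refl (u : V) : HNear G ht 0 u u := rfl

theorem ht_eq (h : HNear G ht b u v) : ht u = ht v := by
  induction b generalizing v with
  | zero => exact congrArg ht h
  | succ b ih => obtain ⟨w, h1, h2, -⟩ := h; exact (ih h1).trans h2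

theorem one (h : ht u = ht v) (h' : u = v ∨ G.Adj u v) : HNear G ht 1 u v := ⟨u, rfl, h, h'⟩

theorem trans (h : HNear G ht a u v) (h' : HNear G ht b v w) : HNear G ht (a + b) u w := by
  induction b generalizing w with
  | zero => obtain rfl : v = w := h'; exact h
  | succ b ih => obtain ⟨z, h1, h2⟩ := h'; exact ⟨z, ih h1, h2⟩

theorem symm (h : HNear G ht b u v) : HNear G ht b v u := by
  induction b generalizing v with
  | zero => exact Eq.symm h
  | succ b ih =>
    obtain ⟨w, h1, h2, h3⟩ := h
    have := (one (G := G) h2.symm (h3.imp Eq.symm (fun h => h.symm))).trans (ih h1)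
    rwa [Nat.add_comm] at this

theorem mono (h : HNear G ht a u v) (hab : a ≤ b) : HNear G ht b u v := by
  induction hab with
  | refl => exact h
  | step _ ih => exact ⟨v, ih, rfl, Or.inl rfl⟩

theorem dist_le (hG : G.Connected) (h : HNear G ht b u v) : G.dist u v ≤ b := by
  induction b generalizing v with
  | zero => obtain rfl : u = v := h; simp
  | succ b ih =>
    obtain ⟨w, h1, -, h3⟩ := h
    have h4 := hG.dist_triangle (u := u) (v := w) (w := v)
    have h5 := ih h1
    rcases h3 with rfl | h3
    · simp at h4; omega
    · rw [SimpleGraph.dist_eq_one_iff_adj.2 h3] at h4; omega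

/-- Two horizontal steps contract to one, and a last odd step still costs one: half the length,
rounded up. -/
theorem proj (hL : IsLayered G ht π) (h : HNear G ht b u v) (hu : 0 < ht u) :
    HNear G ht ((b + 1) / 2) (π u) (π v) := by
  induction b using Nat.strong_induction_on generalizing v with
  | _ b ih =>
    have step : ∀ {x y z : V}, 0 < ht x → ht x = ht y → ht y = ht z → (x = y ∨ G.Adj x y) →
        (y = z ∨ G.Adj y z) → HNear G ht 1 (π x) (π z) := fun h1 h2 h3 h4 h5 =>
      one (by rw [hL.ht_proj, hL.ht_proj, h2, h3]) (hL.contract _ _ _ h1 h2 h3 h4 h5)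
    match b, h with
    | 0, h => obtain rfl : u = v := h; exact refl _
    | 1, h =>
      obtain ⟨w, h1, h2, h3⟩ := h
      obtain rfl : u = w := h1
      exact step hu rfl h2 (Or.inl rfl) h3
    | b + 2, h =>
      obtain ⟨w, ⟨z, h0, h1, h2⟩, h3, h4⟩ := h
      have hz : 0 < ht z := h0.ht_eq ▸ hu
      have := (ih b (by omega) h0).trans (step hz h1 h3 h2 h4)
      rwa [show (b + 1) / 2 + 1 = (b + 2 + 1) / 2 by omega] at this

end HNear

namespace IsLayered

variable (hL : IsLayered G ht π)
include hL

theorem dist_proj_le (hG : G.Connected) (v : V) : G.dist v (π v) ≤ 2 := by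
  obtain ⟨w, h1, h2⟩ := hL.near_proj v
  have aux : ∀ {x y : V}, (x = y ∨ G.Adj x y) → G.dist x y ≤ 1 := by
    rintro x y (rfl | h)
    · simp
    · exact (SimpleGraph.dist_eq_one_iff_adj.2 h).le
  have := hG.dist_triangle (u := v) (v := w) (w := π v)
  have := aux h1
  have := aux h2
  omega

end IsLayered

end Hyperbolicity

/-! ### Shape of geodesics in a layered graph, and hyperbolicity -/

section Layered

variable {V : Type*} {G : SimpleGraph V} {ht : V → ℕ} {π : V → V}

theorem level_of_le {j : ℕ} {v : V} (h : ht v ≤ j) : level ht π j v = v := by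
  simp [level, Nat.sub_eq_zero_of_le h]

theorem level_of_lt {j : ℕ} {v : V} (h : j < ht v) :
    level ht π j v = π (level ht π (j + 1) v) := by
  rw [level, level, show ht v - j = (ht v - (j + 1)) + 1 by omega, Function.iterate_succ_apply']

theorem dist_le_of_hnear (hG : G.Connected) {j b : ℕ} {x y : V}
    (h : HNear G ht b (level ht π j x) (level ht π j y)) :
    G.dist x y ≤ G.dist x (level ht π j x) + G.dist y (level ht π j y) + b := by
  have h1 := hG.dist_triangle (u := x) (v := level ht π j x) (w := y)
  have h2 := hG.dist_triangle (u := level ht π j x) (v := level ht π j y) (w := y)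
  have h3 := h.dist_le hG
  rw [SimpleGraph.dist_comm (u := level ht π j y) (v := y)] at h2
  omega

namespace IsLayered

variable (hL : IsLayered G ht π)
include hL

theorem ht_iterate (k : ℕ) (v : V) : ht (π^[k] v) = ht v - k := by
  induction k with
  | zero => rfl
  | succ k ih => rw [Function.iterate_succ_apply', hL.ht_proj, ih]; omega

theorem ht_level {j : ℕ} {v : V} (h : j ≤ ht v) : ht (level ht π j v) = j := by
  rw [level, hL.ht_iterate]; omega

theorem level_proj {j : ℕ} {v : V} (h : j < ht v) : level ht π j (π v) = level ht π j v := by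
  rw [level, level, hL.ht_proj, ← Function.iterate_succ_apply]
  congr 2
  omega

/-- Since `(c + 1) / 2 ≤ c` for every natural `c`, rounding up never lengthens a path under
projection. -/
theorem hnear_level_of_le {b j k : ℕ} {x y : V} (hkj : k ≤ j) (hx : j ≤ ht x) (hy : j ≤ ht y)
    (h : HNear G ht b (level ht π j x) (level ht π j y)) :
    ∃ c, c ≤ b ∧ HNear G ht c (level ht π k x) (level ht π k y) := by
  induction hkj using Nat.decreasingInduction with
  | self => exact ⟨b, le_rfl, h⟩
  | of_succ i hi ih =>
    obtain ⟨c, hc, h⟩ := ih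
    rw [level_of_lt (by omega : i < ht x), level_of_lt (by omega : i < ht y)]
    exact ⟨_, by omega, h.proj hL (by rw [hL.ht_level (by omega)]; omega)⟩

theorem hnear_level_adj {j : ℕ} {u v : V} (h : G.Adj u v) (hu : j ≤ ht u) (hv : j ≤ ht v) :
    HNear G ht 1 (level ht π j u) (level ht π j v) := by
  rcases hL.adj_cases u v h with h1 | ⟨h1, h2⟩ | ⟨h1, h2⟩
  · obtain ⟨c, hc, h3⟩ := hL.hnear_level_of_le (k := j) hu le_rfl h1.le (b := 1) (by
      rw [level_of_le le_rfl, level_of_le h1.ge]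
      exact HNear.one h1 (Or.inr h))
    exact h3.mono hc
  · rw [← h2, hL.level_proj (by omega)]
    exact (HNear.refl _).mono zero_le_one
  · rw [← h2, hL.level_proj (by omega)]
    exact (HNear.refl _).mono zero_le_one

/-- A walk ending at `v` is, up to a bounded error, at least as long as the walk that descends
from `v` to the lowest level `μ` that it reaches and then moves horizontally. -/
theorem exists_min_level (hG : G.Connected) {u v : V} (p : G.Walk u v) :
    ∃ μ, (∃ w ∈ p.support, ht w = μ) ∧ (∀ w ∈ p.support, μ ≤ ht w) ∧
      (∃ a, HNear G ht a (level ht π μ u) (level ht π μ v) ∧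
        G.dist v (level ht π μ v) + a ≤ p.length + 2) ∧
      ∀ j, μ ≤ j → j ≤ ht v →
        G.dist v (level ht π j v) + G.dist (level ht π j v) u ≤ p.length + 2 := by
  induction p with
  | nil =>
    rename_i v
    refine ⟨ht v, ⟨v, by simp⟩, by simp, ⟨0, HNear.refl _, ?_⟩, fun j h1 h2 => ?_⟩
    · simp [level_of_le]
    · simp [level_of_le h1]
  | cons hadj p ih =>
    rename_i u u' v
    obtain ⟨μ, ⟨w, hw, hwμ⟩, hμ, ⟨a, ha, hlen⟩, hj⟩ := ih
    have hu' : μ ≤ ht u' := hμ _ p.start_mem_support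
    have hv : μ ≤ ht v := hμ _ p.end_mem_support
    have hd : ∀ z, G.dist z u ≤ G.dist z u' + 1 := fun z => by
      have := hG.dist_triangle (u := z) (v := u') (w := u)
      rwa [SimpleGraph.dist_eq_one_iff_adj.2 hadj.symm] at this
    simp only [SimpleGraph.Walk.support_cons, List.mem_cons, SimpleGraph.Walk.length_cons]
    by_cases hu : μ ≤ ht u
    · refine ⟨μ, ⟨w, Or.inr hw, hwμ⟩, ?_, ⟨1 + a, ?_, by omega⟩, fun j h1 h2 => ?_⟩
      · rintro z (rfl | hz)
        exacts [hu, hμ _ hz]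
      · exact (hL.hnear_level_adj hadj hu hu').trans ha
      · have := hj j h1 h2
        have := hd (level ht π j v)
        omega
    · obtain ⟨hu1, hu2⟩ : ht u' = ht u + 1 ∧ π u' = u := by
        rcases hL.adj_cases u u' hadj with h | h | h
        · omega
        · omega
        · exact h
      obtain rfl : μ = ht u + 1 := by omega
      rw [level_of_le hu1.le] at ha
      have hlev : level ht π (ht u) v = π (level ht π (ht u + 1) v) := level_of_lt (by omega)
      have hproj := ha.proj hL (by omega)
      rw [hu2, ← hlev] at hproj
      have hstep : G.dist v (level ht π (ht u) v) ≤ G.dist v (level ht π (ht u + 1) v) + 2 := by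
        have h1 := hG.dist_triangle (u := v) (v := level ht π (ht u + 1) v)
          (w := level ht π (ht u) v)
        have h2 := hL.dist_proj_le hG (level ht π (ht u + 1) v)
        rw [← hlev] at h2
        omega
      -- The walk reaches a new lowest level at `u`. If `a ≥ 2`, halving `a` saves at least 1, which
      -- with the new edge pays for the 2 in `hstep`. If `a ≤ 1` this fails, and the distance is
      -- bounded by going through `u` instead.
      have hstep' : G.dist v (level ht π (ht u) v) ≤ p.length + 1 + (a + 1) / 2 := by
        have h1 := hG.dist_triangle (u := v) (v := u) (w := level ht π (ht u) v)
        have h2 := hproj.dist_le hG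
        have h3 := hd v
        have h4 := SimpleGraph.dist_le p
        rw [SimpleGraph.dist_comm] at h4
        omega
      have hmain : G.dist v (level ht π (ht u) v) + (a + 1) / 2 ≤ p.length + 1 + 2 := by omega
      refine ⟨ht u, ⟨u, Or.inl rfl, rfl⟩, ?_, ⟨(a + 1) / 2, ?_, hmain⟩, fun j h1 h2 => ?_⟩
      · rintro z (rfl | hz)
        · exact le_rfl
        · have := hμ _ hz
          omega
      · rwa [level_of_le le_rfl]
      · rcases Nat.eq_or_lt_of_le h1 with rfl | h1
        · have := hproj.dist_le hG
          rw [SimpleGraph.dist_comm] at this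
          omega
        · have := hj j (by omega) h2
          have := hd (level ht π j v)
          omega

/-- A geodesic starting at `o` has lowest level 0, so the last clause of `exists_min_level` covers
every `j`. -/
theorem dist_level_add_le (hG : G.Connected) {o v : V} (ho : ht o = 0) {j : ℕ} (hj : j ≤ ht v) :
    G.dist v (level ht π j v) + G.dist (level ht π j v) o ≤ G.dist v o + 2 := by
  obtain ⟨p, hp⟩ := hG.exists_walk_length_eq_dist o v
  obtain ⟨μ, -, h1, -, h2⟩ := hL.exists_min_level hG p
  have := h1 _ p.start_mem_support
  rw [SimpleGraph.dist_comm (u := v) (v := o), ← hp]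
  exact h2 j (by omega) hj

/-- A geodesic is cut at a vertex `q` of lowest level. Both halves, read away from `q`, satisfy
`exists_min_level` with error 2. -/
theorem exists_level_hnear (hG : G.Connected) (x y : V) :
    ∃ j a, j ≤ ht x ∧ j ≤ ht y ∧ HNear G ht a (level ht π j x) (level ht π j y) ∧
      G.dist x (level ht π j x) + G.dist y (level ht π j y) + a ≤ G.dist x y + 4 := by
  classical
  obtain ⟨p, hp⟩ := hG.exists_walk_length_eq_dist x y
  obtain ⟨μ, ⟨q, hq, hqμ⟩, hμ, -, -⟩ := hL.exists_min_level hG p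
  have key : ∀ {z : V} (r : G.Walk q z), (∀ w ∈ r.support, μ ≤ ht w) →
      ∃ a, HNear G ht a q (level ht π μ z) ∧ G.dist z (level ht π μ z) + a ≤ r.length + 2 := by
    intro z r hr
    obtain ⟨ν, ⟨w, hw, hwν⟩, hν, ⟨a, ha, hlen⟩, -⟩ := hL.exists_min_level hG r
    have h1 := hr _ hw
    have h2 := hν _ r.start_mem_support
    obtain rfl : ν = μ := by omega
    rw [level_of_le hqμ.le] at ha
    exact ⟨a, ha, hlen⟩
  obtain ⟨a, ha, hla⟩ := key (p.takeUntil q hq).reverse fun w hw =>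
    hμ w (p.support_takeUntil_subset_support hq (by simpa using hw))
  obtain ⟨b, hb, hlb⟩ := key (p.dropUntil q hq) fun w hw =>
    hμ w (p.support_dropUntil_subset_support hq hw)
  have hlen := congrArg SimpleGraph.Walk.length (p.take_spec hq)
  rw [SimpleGraph.Walk.length_append] at hlen
  rw [SimpleGraph.Walk.length_reverse] at hla
  exact ⟨μ, a + b, hμ _ p.start_mem_support, hμ _ p.end_mem_support, ha.symm.trans hb, by omega⟩

/-- There is a level at which the projections of `x` and `y` are close, or which is the bottom
level, and through which geodesics from `x` to `y` essentially descend. -/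
theorem exists_level_close (hG : G.Connected) (o x y : V) :
    ∃ j b, j ≤ ht x ∧ j ≤ ht y ∧ HNear G ht b (level ht π j x) (level ht π j y) ∧
      (b ≤ 8 ∨ j = 0) ∧
      G.dist x o + G.dist y o + b ≤
        G.dist x y + G.dist (level ht π j x) o + G.dist (level ht π j y) o + 4 := by
  obtain ⟨j, a, hx, hy, ha, hlen⟩ := hL.exists_level_hnear hG x y
  have h1 := hG.dist_triangle (u := x) (v := level ht π j x) (w := o)
  have h2 := hG.dist_triangle (u := y) (v := level ht π j y) (w := o)
  replace hlen : G.dist x o + G.dist y o + a ≤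
      G.dist x y + G.dist (level ht π j x) o + G.dist (level ht π j y) o + 4 := by omega
  clear h1 h2
  induction j generalizing a with
  | zero => exact ⟨0, a, hx, hy, ha, Or.inr rfl, hlen⟩
  | succ j ih =>
    -- One more descent costs at most 2 on each side, and `a - (a + 1) / 2 ≥ 4` as soon as `a ≥ 9`:
    -- descending loses nothing until `a ≤ 8`.
    by_cases ha8 : a ≤ 8
    · exact ⟨j + 1, a, hx, hy, ha, Or.inl ha8, hlen⟩
    have hx' : level ht π j x = π (level ht π (j + 1) x) := level_of_lt hx
    have hy' : level ht π j y = π (level ht π (j + 1) y) := level_of_lt hy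
    have h3 := hG.dist_triangle (u := level ht π (j + 1) x) (v := level ht π j x) (w := o)
    have h4 := hG.dist_triangle (u := level ht π (j + 1) y) (v := level ht π j y) (w := o)
    have h5 := hL.dist_proj_le hG (level ht π (j + 1) x)
    have h6 := hL.dist_proj_le hG (level ht π (j + 1) y)
    rw [← hx'] at h5
    rw [← hy'] at h6
    have h7 := ha.proj hL (by rw [hL.ht_level hx]; omega)
    rw [← hx', ← hy'] at h7
    exact ih _ (by omega) (by omega) h7 (by omega)

end IsLayered

/-- A layered graph whose bottom level is a ray `s`, with a coordinate along the ray that is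
constant on vertical edges. -/
structure IsLayeredRay (G : SimpleGraph V) (ht : V → ℕ) (π : V → V) (s : ℕ → V) (pos : V → ℕ) :
    Prop extends IsLayered G ht π where
  ht_ray : ∀ i, ht (s i) = 0
  pos_ray : ∀ i, pos (s i) = i
  eq_ray : ∀ v, ht v = 0 → v = s (pos v)
  adj_ray : ∀ i, G.Adj (s i) (s (i + 1))
  pos_proj : ∀ v, pos (π v) = pos v
  pos_le_of_adj : ∀ u v, G.Adj u v → pos u ≤ pos v + 1

namespace IsLayeredRay

variable {s : ℕ → V} {pos : V → ℕ} (hR : IsLayeredRay G ht π s pos)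
include hR

theorem connected : G.Connected := by
  have aux : ∀ {x y : V}, (x = y ∨ G.Adj x y) → G.Reachable x y := by
    rintro x y (rfl | h)
    exacts [SimpleGraph.Reachable.refl _, h.reachable]
  have hs : ∀ i, G.Reachable (s i) (s 0) := fun i => by
    induction i with
    | zero => exact SimpleGraph.Reachable.refl _
    | succ i ih => exact (hR.adj_ray i).symm.reachable.trans ih
  have hv : ∀ n v, ht v = n → G.Reachable v (s 0) := fun n => by
    induction n with
    | zero => intro v hv; rw [hR.eq_ray v hv]; exact hs _
    | succ n ih =>
      intro v hv
      obtain ⟨w, h1, h2⟩ := hR.near_proj v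
      exact (aux h1).trans ((aux h2).trans (ih _ (by rw [hR.ht_proj, hv]; rfl)))
  have : Nonempty V := ⟨s 0⟩
  exact ⟨fun u v => (hv _ u rfl).trans (hv _ v rfl).symm⟩

theorem pos_le_add_dist (u v : V) : pos u ≤ pos v + G.dist u v := by
  obtain ⟨p, hp⟩ := hR.connected.exists_walk_length_eq_dist u v
  rw [← hp]
  clear hp
  induction p with
  | nil => simp
  | cons h p ih =>
    have := hR.pos_le_of_adj _ _ h
    rw [SimpleGraph.Walk.length_cons]
    omega

theorem dist_ray_add (i j : ℕ) : G.dist (s i) (s (i + j)) = j := by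
  apply le_antisymm
  · induction j with
    | zero => simp
    | succ j ih =>
      have := hR.connected.dist_triangle (u := s i) (v := s (i + j)) (w := s (i + j + 1))
      rw [SimpleGraph.dist_eq_one_iff_adj.2 (hR.adj_ray _)] at this
      rw [← add_assoc]
      omega
  · have := hR.pos_le_add_dist (s (i + j)) (s i)
    rw [hR.pos_ray, hR.pos_ray, SimpleGraph.dist_comm] at this
    omega

theorem dist_ray_zero (i : ℕ) : G.dist (s i) (s 0) = i := by
  have := hR.dist_ray_add 0 i
  rwa [zero_add, SimpleGraph.dist_comm] at this

theorem level_zero (v : V) : level ht π 0 v = s (pos v) := by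
  have h : ∀ k, pos (π^[k] v) = pos v := fun k => by
    induction k with
    | zero => rfl
    | succ k ih => rw [Function.iterate_succ_apply', hR.pos_proj, ih]
  rw [hR.eq_ray _ (hR.ht_level (Nat.zero_le (ht v))), level, h]

theorem pos_le_of_hnear {j b : ℕ} {x y : V} (hx : j ≤ ht x) (hy : j ≤ ht y)
    (h : HNear G ht b (level ht π j x) (level ht π j y)) : pos x ≤ pos y + b := by
  obtain ⟨c, hc, h⟩ := hR.hnear_level_of_le (Nat.zero_le j) hx hy h
  rw [hR.level_zero, hR.level_zero] at h
  have h1 := h.dist_le hR.connected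
  have h2 := hR.pos_le_add_dist (s (pos x)) (s (pos y))
  rw [hR.pos_ray, hR.pos_ray] at h2
  omega

theorem hnear_ray (i j : ℕ) : HNear G ht (i - j + (j - i)) (s i) (s j) := by
  have h : ∀ a b, HNear G ht b (s a) (s (a + b)) := fun a b => by
    induction b with
    | zero => rfl
    | succ b ih => exact ⟨_, ih, by rw [hR.ht_ray, hR.ht_ray], Or.inr (hR.adj_ray _)⟩
  rcases Nat.le_total i j with hij | hij
  · obtain ⟨k, rfl⟩ := Nat.exists_eq_add_of_le hij
    simpa using h i k
  · obtain ⟨k, rfl⟩ := Nat.exists_eq_add_of_le hij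
    simpa using (h j k).symm

theorem isGromovHyperbolic : IsGromovHyperbolic G := by
  have hG := hR.connected
  have hL := hR.toIsLayered
  -- This bounds `(x | z)` from below by the projections at any common level; `exists_level_close`
  -- gives matching upper bounds for `(x | y)` and `(y | z)`.
  have lower : ∀ {j b x z}, j ≤ ht x → j ≤ ht z →
      HNear G ht b (level ht π j x) (level ht π j z) →
      G.dist x z + G.dist (level ht π j x) (s 0) + G.dist (level ht π j z) (s 0) ≤
        G.dist x (s 0) + G.dist z (s 0) + b + 4 := fun hx hz h => by
    have h1 := dist_le_of_hnear hG h
    have h2 := hL.dist_level_add_le hG (hR.ht_ray 0) hx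
    have h3 := hL.dist_level_add_le hG (hR.ht_ray 0) hz
    omega
  refine isGromovHyperbolic_of_basePoint hG (s 0) 24 fun x y z => ?_
  -- The inequality is doubled to clear the halves in the Gromov products, so 24 becomes 48.
  suffices h : G.dist x y + (G.dist x (s 0) + G.dist z (s 0)) + 48 ≥
        G.dist x z + (G.dist x (s 0) + G.dist y (s 0)) ∨
      G.dist y z + (G.dist x (s 0) + G.dist z (s 0)) + 48 ≥
        G.dist x z + (G.dist y (s 0) + G.dist z (s 0)) by
    rw [sub_le_iff_le_add, min_le_iff]
    simp only [gromovProduct]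
    rcases h with h | h
    · left
      have : ((G.dist x y + (G.dist x (s 0) + G.dist z (s 0)) + 48 : ℕ) : ℝ) ≥
        (G.dist x z + (G.dist x (s 0) + G.dist y (s 0)) : ℕ) := by exact_mod_cast h
      push_cast at this
      linarith
    · right
      have : ((G.dist y z + (G.dist x (s 0) + G.dist z (s 0)) + 48 : ℕ) : ℝ) ≥
        (G.dist x z + (G.dist y (s 0) + G.dist z (s 0)) : ℕ) := by exact_mod_cast h
      push_cast at this
      linarith
  obtain ⟨j, b, hjx, hjy, hb, hb8, hxy⟩ := hL.exists_level_close hG (s 0) x y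
  obtain ⟨k, c, hky, hkz, hc, hc8, hyz⟩ := hL.exists_level_close hG (s 0) y z
  -- At level 0 the bound reads `(x | z) ≥ min (pos x) (pos z) - 2`, which settles the cases `j = 0`
  -- and `k = 0`. If only one of them is 0, the other pair has positions within 8 of each other.
  have hxz0 := lower (Nat.zero_le _) (Nat.zero_le _)
    (show HNear G ht _ (level ht π 0 x) (level ht π 0 z) by
      rw [hR.level_zero, hR.level_zero]; exact hR.hnear_ray _ _)
  have p1 := hR.pos_le_of_hnear hjx hjy hb
  have p2 := hR.pos_le_of_hnear hjy hjx hb.symm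
  have p3 := hR.pos_le_of_hnear hky hkz hc
  have p4 := hR.pos_le_of_hnear hkz hky hc.symm
  simp only [hR.level_zero, hR.dist_ray_zero] at hxz0
  rcases Nat.eq_zero_or_pos j with rfl | hj
  · simp only [hR.level_zero, hR.dist_ray_zero] at hxy
    rcases Nat.eq_zero_or_pos k with rfl | hk
    · simp only [hR.level_zero, hR.dist_ray_zero] at hyz
      omega
    · left
      omega
  · rcases Nat.eq_zero_or_pos k with rfl | hk
    · simp only [hR.level_zero, hR.dist_ray_zero] at hyz
      right
      omega
    -- Below both levels the projections of `x` and `z` are each within 8 of that of `y`, hence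
    -- within 16 of each other.
    · have close : ∀ {i}, i ≤ j → i ≤ k → ∃ e, e ≤ 16 ∧
          HNear G ht e (level ht π i x) (level ht π i z) := fun h1 h2 => by
        obtain ⟨e, he, h3⟩ := hL.hnear_level_of_le h1 hjx hjy hb
        obtain ⟨f, hf, h4⟩ := hL.hnear_level_of_le h2 hky hkz hc
        exact ⟨e + f, by omega, h3.trans h4⟩
      rcases Nat.le_total j k with hjk | hjk
      · left
        obtain ⟨e, he, h⟩ := close le_rfl hjk
        have h1 := lower hjx (hjk.trans hkz) h
        have h2 := h.dist_le hG
        have h3 := hb.dist_le hG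
        have h4 := hG.dist_triangle (u := level ht π j x) (v := level ht π j z) (w := s 0)
        have h5 := hG.dist_triangle (u := level ht π j y) (v := level ht π j x) (w := s 0)
        rw [SimpleGraph.dist_comm (u := level ht π j y) (v := level ht π j x)] at h5
        omega
      · right
        obtain ⟨e, he, h⟩ := close hjk le_rfl
        have h1 := lower (hjk.trans hjx) hkz h
        have h2 := h.dist_le hG
        have h3 := hc.dist_le hG
        have h4 := hG.dist_triangle (u := level ht π k z) (v := level ht π k x) (w := s 0)
        have h5 := hG.dist_triangle (u := level ht π k y) (v := level ht π k z) (w := s 0)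
        rw [SimpleGraph.dist_comm (u := level ht π k z) (v := level ht π k x)] at h4
        omega

end IsLayeredRay

end Layered

/-! ### Geodesic rays and the boundary -/

section Rays

variable {V : Type*} {G : SimpleGraph V}

theorem isGeodesicRay_of_dist (hG : G.Connected) {γ : ℕ → V}
    (hadj : ∀ i, G.dist (γ i) (γ (i + 1)) ≤ 1) (hdist : ∀ i, G.dist (γ 0) (γ i) = i) :
    IsGeodesicRay G γ := by
  intro i j
  apply le_antisymm
  · induction j with
    | zero => simp
    | succ j ih =>
      have h1 := hG.dist_triangle (u := γ i) (v := γ (i + j)) (w := γ (i + j + 1))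
      have h2 := hadj (i + j)
      rw [← add_assoc]
      omega
  · have h1 := hG.dist_triangle (u := γ 0) (v := γ i) (w := γ (i + j))
    rw [hdist, hdist] at h1
    omega

theorem IsGeodesicRay.adj {γ : ℕ → V} (h : IsGeodesicRay G γ) (i : ℕ) :
    G.Adj (γ i) (γ (i + 1)) := SimpleGraph.dist_eq_one_iff_adj.1 (h i 1)

/-- A geodesic to a vertex `s m₀` extends along `s` to a geodesic ray, if the distance to the
vertices of `s` beyond `s m₀` grows linearly. -/
theorem exists_isGeodesicRay_of_dist_eq (hG : G.Connected) {s : ℕ → V}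
    (hs : ∀ i, G.Adj (s i) (s (i + 1))) {x : V} {m₀ : ℕ}
    (h : ∀ m, G.dist x (s (m₀ + m)) = G.dist x (s m₀) + m) :
    ∃ γ, IsGeodesicRay G γ ∧ γ 0 = x := by
  obtain ⟨p, hp⟩ := hG.exists_walk_length_eq_dist x (s m₀)
  let γ : ℕ → V := fun i => if i < p.length then p.getVert i else s (m₀ + (i - p.length))
  have hγ0 : γ 0 = x := by
    simp only [γ]
    split_ifs with h0
    · exact p.getVert_zero
    · have h1 : G.dist x (s m₀) = 0 := by omega
      simp only [Nat.zero_sub, add_zero]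
      exact ((hG.dist_eq_zero_iff).1 h1).symm
  have hadj : ∀ i, G.dist (γ i) (γ (i + 1)) ≤ 1 := fun i => by
    apply le_of_eq
    rw [SimpleGraph.dist_eq_one_iff_adj]
    simp only [γ]
    split_ifs with h1 h2 h2
    · exact p.adj_getVert_succ h1
    · have h3 := p.adj_getVert_succ h1
      obtain h4 : i + 1 = p.length := by omega
      rw [h4, p.getVert_length] at h3
      simpa [h4] using h3
    · omega
    · rw [show i + 1 - p.length = i - p.length + 1 by omega]
      exact hs _
  refine ⟨γ, isGeodesicRay_of_dist hG hadj fun i => ?_, hγ0⟩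
  have upper : ∀ i j, G.dist (γ i) (γ (i + j)) ≤ j := fun i j => by
    induction j with
    | zero => simp
    | succ j ih =>
      have h1 := hG.dist_triangle (u := γ i) (v := γ (i + j)) (w := γ (i + j + 1))
      have h2 := hadj (i + j)
      rw [← add_assoc]
      omega
  have far : ∀ i, p.length ≤ i → G.dist (γ 0) (γ i) = i := fun i hi => by
    rw [hγ0]
    simp only [γ, if_neg (not_lt.2 hi)]
    rw [h]
    omega
  -- On the initial segment, distances grow by at most 1 per step and are exact at its end, so they
  -- are exact throughout.
  rcases Nat.le_total p.length i with hi | hi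
  · exact far i hi
  · have h1 := upper 0 i
    have h2 := upper i (p.length - i)
    have h3 := far _ le_rfl
    rw [zero_add] at h1
    rw [show i + (p.length - i) = p.length by omega] at h2
    have h4 := hG.dist_triangle (u := γ 0) (v := γ i) (w := γ p.length)
    omega

/-- Geodesic rays from the same vertex with tails in a ray `s` eventually coincide. -/
theorem IsGeodesicRay.eventually_eq_of_tail {s γ γ' : ℕ → V} (hγ : IsGeodesicRay G γ)
    (hγ' : IsGeodesicRay G γ')
    (h0 : γ 0 = γ' 0) (h : ∃ N a, ∀ i, γ (N + i) = s (a + i))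
    (h' : ∃ N a, ∀ i, γ' (N + i) = s (a + i)) : ∃ N, ∀ i, N ≤ i → γ i = γ' i := by
  obtain ⟨N, a, h⟩ := h
  obtain ⟨M, b, h'⟩ := h'
  have h1 : N + b = M + a := by
    have h2 := hγ 0 (N + b)
    have h3 := hγ' 0 (M + a)
    rw [zero_add, h] at h2
    rw [zero_add, h', ← h0, add_comm b a] at h3
    omega
  refine ⟨N + M, fun i hi => ?_⟩
  obtain ⟨k, rfl⟩ := Nat.exists_eq_add_of_le hi
  rw [show γ (N + M + k) = s (a + (M + k)) by rw [add_assoc, h],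
    show γ' (N + M + k) = s (b + (N + k)) by rw [add_comm N M, add_assoc, h']]
  congr 1
  omega

variable {ht : V → ℕ} {π : V → V} {s : ℕ → V} {pos : V → ℕ}

namespace IsLayeredRay

variable (hR : IsLayeredRay G ht π s pos)
include hR

theorem isGeodesicRay : IsGeodesicRay G s := hR.dist_ray_add

/-- The quantity `φ m`, a Busemann function along `s` shifted by `pos x`, is a natural number that
never increases; `lower` shows that its subtraction does not truncate. From a minimum `m₀` onwards
it is constant, that is, the distance from `x` grows by exactly 1 per step. -/
theorem exists_isGeodesicRay (x : V) : ∃ γ, IsGeodesicRay G γ ∧ γ 0 = x := by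
  have hG := hR.connected
  have lower : ∀ m, m ≤ pos x + G.dist x (s m) := fun m => by
    have := hR.pos_le_add_dist (s m) x
    rwa [hR.pos_ray, SimpleGraph.dist_comm] at this
  let φ : ℕ → ℕ := fun m => pos x + G.dist x (s m) - m
  obtain ⟨m₀, hm₀⟩ : ∃ m₀, ∀ m, φ m₀ ≤ φ m :=
    ⟨Function.argmin φ, fun m => Function.argmin_le φ m⟩
  refine exists_isGeodesicRay_of_dist_eq hG hR.adj_ray (x := x) (m₀ := m₀) fun m => ?_
  have h1 := hm₀ (m₀ + m)
  have h2 := hG.dist_triangle (u := x) (v := s m₀) (w := s (m₀ + m))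
  rw [hR.dist_ray_add] at h2
  have h3 := lower m₀
  have h4 := lower (m₀ + m)
  simp only [φ] at h1
  omega

theorem dist_ray_pos_le (v : V) : G.dist v (s (pos v)) ≤ 2 * ht v := by
  have h : ∀ k, G.dist v (π^[k] v) ≤ 2 * k := fun k => by
    induction k with
    | zero => simp
    | succ k ih =>
      have h1 := hR.connected.dist_triangle (u := v) (v := π^[k] v) (w := π^[k + 1] v)
      have h2 := hR.dist_proj_le hR.connected (π^[k] v)
      rw [← Function.iterate_succ_apply' π k v, Nat.succ_eq_add_one] at h2
      omega
  rw [← hR.level_zero]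
  exact h _

/-- A geodesic between two vertices of `s` runs along `s`. -/
theorem eq_ray_of_isGeodesicRay {γ : ℕ → V} (hγ : IsGeodesicRay G γ) {n b : ℕ}
    (h0 : ht (γ n) = 0) (hb : ht (γ (n + b)) = 0) (hlt : pos (γ n) < b) {i : ℕ} (hi : i ≤ b) :
    γ (n + i) = s (pos (γ n) + i) := by
  have hmono : ∀ j k, pos (γ (n + (j + k))) ≤ pos (γ (n + j)) + k := fun j k => by
    have := hR.pos_le_add_dist (γ (n + j + k)) (γ (n + j))
    rwa [SimpleGraph.dist_comm, hγ, add_assoc] at this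
  -- The two positions differ by exactly `b`, and `hlt` leaves no room to run towards `s 0`.
  have hend : pos (γ (n + b)) = pos (γ n) + b := by
    have h1 := hγ n b
    rw [hR.eq_ray _ h0, hR.eq_ray _ hb] at h1
    have h2 := (hR.hnear_ray (pos (γ n)) (pos (γ (n + b)))).dist_le hR.connected
    have h3 := hmono 0 b
    rw [zero_add, add_zero] at h3
    omega
  have hpos : ∀ i ≤ b, pos (γ (n + i)) = pos (γ n) + i := fun i hi => by
    have h1 := hmono 0 i
    have h2 := hmono i (b - i)
    rw [show i + (b - i) = b by omega] at h2
    rw [zero_add, add_zero] at h1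
    omega
  -- The position must rise by 1 at every step, whereas a vertical edge preserves it.
  have hht : ∀ i ≤ b, ht (γ (n + i)) = 0 := fun i hi => by
    induction i with
    | zero => exact h0
    | succ i ih =>
      have h1 := ih (by omega)
      have h2 := hpos i (by omega)
      have h3 := hpos (i + 1) hi
      rw [← add_assoc] at h3 ⊢
      rcases hR.adj_cases _ _ (hγ.adj (n + i)) with h | ⟨h, -⟩ | ⟨-, h⟩
      · omega
      · omega
      · have := hR.pos_proj (γ (n + i + 1))
        rw [h] at this
        omega
  rw [← hpos i hi]
  exact hR.eq_ray _ (hht i hi)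

/-- If the vertices of positive height fall into bounded pieces that are not joined by edges, then
geodesic rays eventually run along `s`. -/
theorem exists_tail {c : V → ℕ} {B : ℕ → ℕ}
    (hc : ∀ u v, G.Adj u v → 0 < ht u → 0 < ht v → c u = c v)
    (hB : ∀ v, 0 < ht v → ht v ≤ B (c v) ∧ pos v ≤ B (c v))
    {γ : ℕ → V} (hγ : IsGeodesicRay G γ) : ∃ N a, ∀ i, γ (N + i) = s (a + i) := by
  have hG := hR.connected
  -- A ray avoiding height 0 after time `N` would stay in a single piece, within `3 * B` of `s 0`;
  -- but two of its vertices are at distance `6 * B + 1`.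
  have visit : ∀ N, ∃ i, ht (γ (N + i)) = 0 := fun N => by
    by_contra! hpos
    have hcc : ∀ i, c (γ (N + i)) = c (γ N) := fun i => by
      induction i with
      | zero => rfl
      | succ i ih =>
        rw [← ih]
        exact (hc _ _ (hγ.adj (N + i)) (Nat.pos_of_ne_zero (hpos i))
          (Nat.pos_of_ne_zero (hpos (i + 1)))).symm
    have hbd : ∀ i, G.dist (γ (N + i)) (s 0) ≤ 3 * B (c (γ N)) := fun i => by
      have h1 := hB _ (Nat.pos_of_ne_zero (hpos i))
      rw [hcc] at h1
      have h2 := hR.dist_ray_pos_le (γ (N + i))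
      have h3 := hG.dist_triangle (u := γ (N + i)) (v := s (pos (γ (N + i)))) (w := s 0)
      rw [hR.dist_ray_zero] at h3
      omega
    have h1 := hbd 0
    have h2 := hbd (6 * B (c (γ N)) + 1)
    have h3 := hG.dist_triangle (u := γ N) (v := s 0) (w := γ (N + (6 * B (c (γ N)) + 1)))
    rw [hγ, SimpleGraph.dist_comm (u := s 0)] at h3
    rw [add_zero] at h1
    omega
  obtain ⟨n, hn⟩ := visit 0
  rw [zero_add] at hn
  refine ⟨n, pos (γ n), fun i => ?_⟩
  -- The return to `s` is taken later than `pos (γ n)` steps, to exclude the backward direction, and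
  -- later than `i` steps, to cover index `i`.
  obtain ⟨j, hj⟩ := visit (n + (pos (γ n) + 1 + i))
  rw [add_assoc] at hj
  exact hR.eq_ray_of_isGeodesicRay hγ hn hj (by omega) (by omega)

theorem card_hyperbolicBoundary
    (htail : ∀ γ, IsGeodesicRay G γ → ∃ N a, ∀ i, γ (N + i) = s (a + i)) :
    Nat.card (HyperbolicBoundary G) = 1 := by
  have hG := hR.connected
  have key : ∀ γ : {γ : ℕ → V // IsGeodesicRay G γ},
      (rayEquiv G).r γ ⟨s, hR.isGeodesicRay⟩ := by
    rintro ⟨γ, hγ⟩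
    obtain ⟨N, a, h⟩ := htail γ hγ
    -- From time `N` on, `γ` is a fixed shift of `s`; before that, `γ i` is at distance `N - i` from
    -- `s a`.
    refine ⟨2 * N + a, fun i => ?_⟩
    rw [← (hG _ _).coe_dist_eq_edist, Nat.cast_le]
    change G.dist (γ i) (s i) ≤ _
    rcases Nat.le_total N i with hi | hi
    · obtain ⟨k, rfl⟩ := Nat.exists_eq_add_of_le hi
      rw [h]
      have := (hR.hnear_ray (a + k) (N + k)).dist_le hG
      omega
    · have h1 := hγ i (N - i)
      rw [show i + (N - i) = N + 0 by omega, h] at h1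
      have h2 := hG.dist_triangle (u := γ i) (v := s (a + 0)) (w := s i)
      have h3 := (hR.hnear_ray (a + 0) i).dist_le hG
      omega
  rw [Nat.card_eq_one_iff_unique]
  refine ⟨⟨fun x y => ?_⟩, ⟨Quotient.mk _ ⟨s, hR.isGeodesicRay⟩⟩⟩
  induction x using Quotient.inductionOn with | _ x
  induction y using Quotient.inductionOn with | _ y
  exact Quotient.sound ((rayEquiv G).trans (key x) ((rayEquiv G).symm (key y)))

end IsLayeredRay

end Rays

/-! ### Adjacency and projection in `H3` and the meatballs -/

section Meatballs

/-- The tree neighbour one level closer to the root (the root is its own parent). -/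
def TVert.parent (t : TVert) : TVert :=
  ⟨t.1 - 1, t.2.val / 3, by
    obtain ⟨n, j, hj⟩ := t
    cases n with
    | zero => simp at hj; simp [hj]
    | succ n =>
      rw [pow_succ] at hj
      exact Nat.div_lt_of_lt_mul (by simpa [mul_comm] using hj)⟩

/-- The projection of a vertex of `H₃` to the next lower height. -/
def H3Vert.parent (v : H3Vert) : H3Vert :=
  ⟨(TVert.parent v.1.1, (v.1.2.1 - 1, v.1.2.2 / 2)), congrArg (· - 1) v.2⟩

/-- Equality or adjacency on a level cycle, as a congruence. -/
theorem levelCycles_iff {n j j' : ℕ} (hj : j < 3 ^ n) (hj' : j' < 3 ^ n) :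
    (j = j' ∨ j' = (j + 1) % 3 ^ n ∨ j = (j' + 1) % 3 ^ n) ↔
      ∃ d c : ℤ, -1 ≤ d ∧ d ≤ 1 ∧ (j' : ℤ) = j + d + c * (3 ^ n : ℕ) := by
  generalize 3 ^ n = N at *
  constructor
  · rintro (h | h | h)
    · exact ⟨0, 0, by omega, by omega, by omega⟩
    · rcases Nat.lt_or_ge (j + 1) N with h1 | h1
      · rw [Nat.mod_eq_of_lt h1] at h
        exact ⟨1, 0, by omega, by omega, by omega⟩
      · obtain rfl : N = j + 1 := by omega
        rw [Nat.mod_self] at h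
        exact ⟨1, -1, by omega, by omega, by omega⟩
    · rcases Nat.lt_or_ge (j' + 1) N with h1 | h1
      · rw [Nat.mod_eq_of_lt h1] at h
        exact ⟨-1, 0, by omega, by omega, by omega⟩
      · obtain rfl : N = j' + 1 := by omega
        rw [Nat.mod_self] at h
        exact ⟨-1, 1, by omega, by omega, by omega⟩
  · rintro ⟨d, c, h1, h2, h⟩
    have hN : (0 : ℤ) < N := by omega
    have hc1 : c < 2 := by
      by_contra hc
      have : 2 * (N : ℤ) ≤ c * N := mul_le_mul_of_nonneg_right (by omega) hN.le
      omega
    have hc2 : -2 < c := by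
      by_contra hc
      have : c * N ≤ -2 * (N : ℤ) := mul_le_mul_of_nonneg_right (by omega) hN.le
      omega
    obtain rfl | rfl | rfl : c = -1 ∨ c = 0 ∨ c = 1 := by omega
    · by_cases hd : j + 1 = N
      · right; left
        rw [hd, Nat.mod_self]; omega
      · left; omega
    · rcases lt_trichotomy d 0 with hd | hd | hd
      · right; right
        rw [Nat.mod_eq_of_lt] <;> omega
      · left; omega
      · right; left
        rw [Nat.mod_eq_of_lt] <;> omega
    · by_cases hd : j' + 1 = N
      · right; right
        rw [hd, Nat.mod_self]; omega
      · left; omega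

/-- With the wrap-around recorded by an integer `c`, consecutive steps on a level cycle simply add
up, as `parent_adj` needs. -/
theorem H2_adj_of_height_eq {t t' : TVert} (h : t.1 = t'.1) :
    (t = t' ∨ H2.Adj t t') ↔
      ∃ d c : ℤ, -1 ≤ d ∧ d ≤ 1 ∧ (t'.2.val : ℤ) = t.2.val + d + c * (3 ^ t.1 : ℕ) := by
  obtain ⟨n, j, hj⟩ := t
  obtain ⟨n', j', hj'⟩ := t'
  obtain rfl : n = n' := h
  rw [← levelCycles_iff hj hj']
  have hne : n ≠ n + 1 := by omega
  simp only [H2, T3, levelCycles, SimpleGraph.sup_adj, SimpleGraph.fromRel_adj, hne, false_and,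
    or_self, and_false, false_or, true_and, ne_eq, Sigma.mk.injEq, heq_eq_eq, Fin.mk.injEq]
  tauto

theorem H2_adj_cases {t t' : TVert} (h : H2.Adj t t') :
    t.1 = t'.1 ∨ (t.1 = t'.1 + 1 ∧ t.parent = t') ∨ (t'.1 = t.1 + 1 ∧ t'.parent = t) := by
  have key : ∀ u v : TVert, v.1 = u.1 + 1 → v.2.val / 3 = u.2.val → v.parent = u := by
    rintro ⟨n, j⟩ ⟨n', j'⟩ h1 h2
    simp only at h1
    subst h1
    simp only [TVert.parent]
    congr 1
    exact Fin.ext h2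
  simp only [H2, T3, levelCycles, SimpleGraph.sup_adj, SimpleGraph.fromRel_adj] at h
  rcases h with ⟨-, h | h⟩ | ⟨-, h | h⟩
  · exact Or.inr (Or.inr ⟨h.1, key _ _ h.1 h.2⟩)
  · exact Or.inr (Or.inl ⟨h.1, key _ _ h.1 h.2⟩)
  · exact Or.inl h.1.symm
  · exact Or.inl h.1

theorem W_adj_cases {w w' : WVert} (h : W.Adj w w') :
    (w.1 = w'.1 ∧ w.2 ≤ w'.2 + 1 ∧ w'.2 ≤ w.2 + 1) ∨ (w.1 = w'.1 + 1 ∧ w.2 = 2 * w'.2) ∨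
      (w'.1 = w.1 + 1 ∧ w'.2 = 2 * w.2) := by
  simp only [W, SimpleGraph.fromRel_adj] at h
  omega

theorem W_adj_of_height_eq {w w' : WVert} (h : w.1 = w'.1) (h1 : w.2 ≤ w'.2 + 1)
    (h2 : w'.2 ≤ w.2 + 1) : w = w' ∨ W.Adj w w' := by
  obtain ⟨i, k⟩ := w
  obtain ⟨i', k'⟩ := w'
  simp only [W, SimpleGraph.fromRel_adj, ne_eq, Prod.mk.injEq] at *
  omega

/-- Two vertices of `H₃` of the same height that are equal or adjacent. -/
theorem H3_adj_of_height_eq {u v : H3Vert} (h : height u = height v) :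
    (u = v ∨ H3.Adj u v) ↔
      (∃ d c : ℤ, -1 ≤ d ∧ d ≤ 1 ∧
        (v.1.1.2.val : ℤ) = u.1.1.2.val + d + c * (3 ^ height u : ℕ)) ∧
      u.1.2.2 ≤ v.1.2.2 + 1 ∧ v.1.2.2 ≤ u.1.2.2 + 1 := by
  obtain ⟨⟨t, w⟩, hu⟩ := u
  obtain ⟨⟨t', w'⟩, hv⟩ := v
  simp only [height] at *
  rw [← hu, ← H2_adj_of_height_eq (hu.trans (h.trans hv.symm))]
  simp only [H3, Subtype.mk.injEq, Prod.mk.injEq]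
  constructor
  · rintro (⟨rfl, rfl⟩ | ⟨h1, h2⟩ | ⟨h1, rfl⟩ | ⟨rfl, h2⟩)
    · exact ⟨Or.inl rfl, by omega, by omega⟩
    · have := W_adj_cases h2
      exact ⟨Or.inr h1, by omega, by omega⟩
    · exact ⟨Or.inr h1, by omega, by omega⟩
    · have := W_adj_cases h2
      exact ⟨Or.inl rfl, by omega, by omega⟩
  · rintro ⟨h1, h2, h3⟩
    have := W_adj_of_height_eq h h2 h3
    tauto

/-- Since the heights of the two coordinates agree, a vertical edge must move both. Then its lower
end has the parent as tree coordinate, and `2 * k / 2 = k` in `W`. -/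
theorem H3_adj_cases {u v : H3Vert} (h : H3.Adj u v) :
    height u = height v ∨ (height u = height v + 1 ∧ u.parent = v) ∨
      (height v = height u + 1 ∧ v.parent = u) := by
  obtain ⟨⟨t, w⟩, hu⟩ := u
  obtain ⟨⟨t', w'⟩, hv⟩ := v
  simp only at hu hv
  simp only [H3, height, Prod.ext_iff] at *
  have hT := @H2_adj_cases t t'
  have hW := @W_adj_cases w w'
  rcases h with ⟨h1, h2⟩ | ⟨h1, h2, h3⟩ | ⟨rfl, h2⟩
  · rcases hT h1 with h3 | ⟨h3, h4⟩ | ⟨h3, h4⟩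
    · left; omega
    · right; left
      have := hW h2
      refine ⟨by omega, Subtype.ext (Prod.ext h4 (Prod.ext ?_ ?_))⟩ <;>
        simp only [H3Vert.parent] <;> omega
    · right; right
      have := hW h2
      refine ⟨by omega, Subtype.ext (Prod.ext h4 (Prod.ext ?_ ?_))⟩ <;>
        simp only [H3Vert.parent] <;> omega
  · left; omega
  · left; omega

theorem height_parent (v : H3Vert) : height v.parent = height v - 1 := rfl

theorem parent_mem_meatball {n : ℕ} {v : H3Vert} (hv : v ∈ meatball n) (hpos : 0 < height v) :
    v.parent ∈ meatball n := by
  obtain ⟨⟨t, i, k⟩, hu⟩ := v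
  simp only [meatball, box, height, H3Vert.parent, Set.mem_ofPred_eq] at *
  obtain ⟨i, rfl⟩ : ∃ m, i = m + 1 := ⟨i - 1, by omega⟩
  rw [pow_succ, ← mul_assoc] at hv
  simp only [Nat.add_sub_cancel]
  omega

/-- Projecting to the next lower height contracts horizontal paths of length two. -/
theorem parent_adj {u w v : H3Vert} (hpos : 0 < height u) (huw : height u = height w)
    (hwv : height w = height v) (h1 : u = w ∨ H3.Adj u w) (h2 : w = v ∨ H3.Adj w v) :
    u.parent = v.parent ∨ H3.Adj u.parent v.parent := by
  rw [H3_adj_of_height_eq huw] at h1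
  rw [H3_adj_of_height_eq hwv, ← huw] at h2
  rw [H3_adj_of_height_eq (by rw [height_parent, height_parent, huw, hwv]), height_parent]
  obtain ⟨⟨d, c, hd, hd', hc⟩, hk⟩ := h1
  obtain ⟨⟨e, b, he, he', hb⟩, hl⟩ := h2
  simp only [H3Vert.parent, TVert.parent]
  -- Two steps change either index by at most 2, the tree index up to `c + b` turns of `3 ^ height
  -- u`. Division by 3 or by 2 leaves a change of at most 1, and the turns become turns of the
  -- shorter cycle.
  refine ⟨⟨((v.1.1.2.val / 3 : ℕ) : ℤ) - ((u.1.1.2.val / 3 : ℕ) : ℤ)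
    - (c + b) * (3 ^ (height u - 1) : ℕ), c + b, ?_, ?_, by ring⟩, by omega, by omega⟩
  all_goals
    obtain ⟨m, hm⟩ : ∃ m, height u = m + 1 := ⟨height u - 1, by omega⟩
    rw [hm, pow_succ] at hc hb
    rw [hm, Nat.add_sub_cancel]
    generalize 3 ^ m = N at *
    push_cast at hc hb ⊢
    rw [add_mul]
    rw [← mul_assoc] at hc hb
    omega

/-- In `W` only even indices have a neighbour one level down. The index is first rounded down to an
even one, which stays in the box; then a diagonal edge leads to the parent. -/
theorem exists_near_parent {n : ℕ} {v : H3Vert} (hv : v ∈ meatball n) (hpos : 0 < height v) :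
    ∃ w ∈ meatball n, (v = w ∨ H3.Adj v w) ∧ H3.Adj w v.parent := by
  refine ⟨⟨(v.1.1, (v.1.2.1, 2 * (v.1.2.2 / 2))), v.2⟩, ?_, ?_, ?_⟩
  · simp only [meatball, box, Set.mem_ofPred_eq] at *
    omega
  · refine (H3_adj_of_height_eq (u := v)
      (v := ⟨(v.1.1, (v.1.2.1, 2 * (v.1.2.2 / 2))), v.2⟩) rfl).2 ⟨⟨0, 0, by simp⟩, ?_, ?_⟩ <;>
    · simp only
      omega
  · obtain ⟨⟨⟨n, j⟩, i, k⟩, h⟩ := v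
    simp only at h
    subst h
    simp only [height] at hpos
    refine Or.inl ⟨Or.inl ((SimpleGraph.fromRel_adj _ _ _).2 ⟨fun h => ?_, Or.inr ⟨?_, rfl⟩⟩),
      (SimpleGraph.fromRel_adj _ _ _).2 ⟨fun h => ?_, Or.inr (Or.inr ⟨?_, rfl⟩)⟩⟩
    · have := congrArg Sigma.fst h
      simp only [H3Vert.parent, TVert.parent] at this
      omega
    · simp only [H3Vert.parent, TVert.parent]
      omega
    · have := congrArg Prod.fst h
      simp only [H3Vert.parent] at this
      omega
    · simp only [H3Vert.parent]
      omega

end Meatballs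

/-! ### The layered structure of `Psi` -/

namespace PsiVert

/-- The height of a vertex of `Ψ`. -/
def ht : PsiVert → ℕ
  | skewer _ => 0
  | inner _ v _ _ _ => height v

/-- The projection of a vertex of `Ψ` to the next lower height. -/
def proj : PsiVert → PsiVert
  | skewer i => skewer i
  | inner n v hn hv hpos => glue n hn v.parent (parent_mem_meatball hv hpos)

/-- The position on the skewer below a vertex of `Ψ`. -/
def pos : PsiVert → ℕ
  | skewer i => i
  | inner n v _ _ _ => glueStart n + (v.1.2.2 / 2 ^ height v).toNat

/-- The index of the meatball that contains a vertex of positive height. -/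
def index : PsiVert → ℕ
  | skewer _ => 0
  | inner n _ _ _ _ => n

end PsiVert

open PsiVert

theorem glue_of_pos {n : ℕ} {hn : 1 ≤ n} {v : H3Vert} {hv : v ∈ meatball n} (h : 0 < height v) :
    glue n hn v hv = inner n v hn hv h := dif_pos h

theorem glue_of_zero {n : ℕ} {hn : 1 ≤ n} {v : H3Vert} {hv : v ∈ meatball n}
    (h : height v = 0) : glue n hn v hv = skewer (glueStart n + v.1.2.2.toNat) :=
  dif_neg (by omega)

theorem ht_glue {n : ℕ} {hn : 1 ≤ n} {v : H3Vert} {hv : v ∈ meatball n} :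
    (glue n hn v hv).ht = height v := by
  rcases Nat.eq_zero_or_pos (height v) with h | h
  · rw [glue_of_zero h, h]; rfl
  · rw [glue_of_pos h]; rfl

theorem pos_glue {n : ℕ} {hn : 1 ≤ n} {v : H3Vert} {hv : v ∈ meatball n} :
    (glue n hn v hv).pos = glueStart n + (v.1.2.2 / 2 ^ height v).toNat := by
  rcases Nat.eq_zero_or_pos (height v) with h | h
  · rw [glue_of_zero h, h]; simp [PsiVert.pos]
  · rw [glue_of_pos h]; rfl

theorem proj_glue {n : ℕ} {hn : 1 ≤ n} {u v : H3Vert} {hu : u ∈ meatball n} {hv : v ∈ meatball n}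
    (hpos : 0 < height u) (h : u.parent = v) : (glue n hn u hu).proj = glue n hn v hv := by
  subst h
  rw [glue_of_pos hpos]
  rfl

theorem Psi_adj_glue {n : ℕ} {hn : 1 ≤ n} {u v : H3Vert} {hu : u ∈ meatball n}
    {hv : v ∈ meatball n} (h : u = v ∨ H3.Adj u v) :
    glue n hn u hu = glue n hn v hv ∨ Psi.Adj (glue n hn u hu) (glue n hn v hv) := by
  by_cases he : glue n hn u hu = glue n hn v hv
  · exact Or.inl he
  · rcases h with rfl | h
    · exact absurd rfl he
    · exact Or.inr ((SimpleGraph.fromRel_adj _ _ _).2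
        ⟨he, Or.inl (Or.inr ⟨n, hn, u, v, hu, hv, h, rfl, rfl⟩)⟩)

theorem Psi_adj_cases {p q : PsiVert} (h : Psi.Adj p q) :
    (∃ i, (p = skewer i ∧ q = skewer (i + 1)) ∨ (q = skewer i ∧ p = skewer (i + 1))) ∨
    ∃ (n : ℕ) (hn : 1 ≤ n) (u v : H3Vert) (hu : u ∈ meatball n) (hv : v ∈ meatball n),
      H3.Adj u v ∧ p = glue n hn u hu ∧ q = glue n hn v hv := by
  rcases ((SimpleGraph.fromRel_adj _ _ _).1 h).2 with (⟨i, h⟩ | h) | (⟨i, h⟩ | h)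
  · exact Or.inl ⟨i, Or.inl h⟩
  · exact Or.inr h
  · exact Or.inl ⟨i, Or.inr h⟩
  · obtain ⟨n, hn, u, v, hu, hv, h, h1, h2⟩ := h
    exact Or.inr ⟨n, hn, v, u, hv, hu, h.symm, h2, h1⟩

/-- At positive height `glue` is injective and remembers the meatball, so an edge between inner
vertices comes from a single meatball. -/
theorem Psi_adj_inner {n n' : ℕ} {u v : H3Vert} {hn hn' hu hv hpos hpos'}
    (h : Psi.Adj (inner n u hn hu hpos) (inner n' v hn' hv hpos')) : n = n' ∧ H3.Adj u v := by
  rcases Psi_adj_cases h with ⟨i, h | h⟩ | ⟨m, hm, u', v', hu', hv', h, h1, h2⟩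
  · cases h.1
  · cases h.1
  · have hu0 : 0 < height u' := by
      have := congrArg PsiVert.ht h1
      rw [ht_glue] at this
      exact this ▸ hpos
    have hv0 : 0 < height v' := by
      have := congrArg PsiVert.ht h2
      rw [ht_glue] at this
      exact this ▸ hpos'
    rw [glue_of_pos hu0, inner.injEq] at h1
    rw [glue_of_pos hv0, inner.injEq] at h2
    obtain ⟨rfl, rfl⟩ := h1
    obtain ⟨rfl, rfl⟩ := h2
    exact ⟨rfl, h⟩

theorem isLayered_Psi : IsLayered Psi ht proj where
  ht_proj := by
    rintro (i | ⟨n, v, hn, hv, hpos⟩)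
    · rfl
    · exact ht_glue
  adj_cases := by
    intro p q h
    rcases Psi_adj_cases h with ⟨i, ⟨rfl, rfl⟩ | ⟨rfl, rfl⟩⟩ | ⟨n, hn, u, v, hu, hv, hH, rfl, rfl⟩
    · exact Or.inl rfl
    · exact Or.inl rfl
    · simp only [ht_glue]
      rcases H3_adj_cases hH with h | ⟨h, h'⟩ | ⟨h, h'⟩
      · exact Or.inl h
      · exact Or.inr (Or.inl ⟨h, proj_glue (by omega) h'⟩)
      · exact Or.inr (Or.inr ⟨h, proj_glue (by omega) h'⟩)
  near_proj := by
    rintro (i | ⟨n, v, hn, hv, hpos⟩)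
    · exact ⟨_, Or.inl rfl, Or.inl rfl⟩
    · obtain ⟨w, hw, h1, h2⟩ := exists_near_parent hv hpos
      refine ⟨glue n hn w hw, ?_, Psi_adj_glue (Or.inr h2)⟩
      rw [← glue_of_pos hpos]
      exact Psi_adj_glue h1
  contract := by
    rintro (i | ⟨n, u, hn, hu, hu0⟩) (j | ⟨m, w, hm, hw, hw0⟩) (k | ⟨l, v, hl, hv, hv0⟩)
      h0 h1 h2 h3 h4 <;> simp only [ht, lt_irrefl] at h0 h1 h2 <;> try omega
    have key : ∀ {n n' : ℕ} {u v : H3Vert} {hn hn' hu hv hpos hpos'},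
        (inner n u hn hu hpos = inner n' v hn' hv hpos' ∨
          Psi.Adj (inner n u hn hu hpos) (inner n' v hn' hv hpos')) →
        n = n' ∧ (u = v ∨ H3.Adj u v) := by
      rintro n n' u v hn hn' hu hv hpos hpos' (h | h)
      · rw [inner.injEq] at h
        exact ⟨h.1, Or.inl h.2⟩
      · exact (Psi_adj_inner h).imp_right Or.inr
    obtain ⟨rfl, huw⟩ := key h3
    obtain ⟨rfl, hwv⟩ := key h4
    exact Psi_adj_glue (parent_adj h0 h1 h2 huw hwv)

/-- Nested floors compose: halving and then dividing by `2 ^ m` is division by `2 ^ (m + 1)`. Hence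
projection preserves `pos`. -/
theorem parent_ediv {v : H3Vert} (hpos : 0 < height v) :
    v.parent.1.2.2 / 2 ^ height v.parent = v.1.2.2 / 2 ^ height v := by
  obtain ⟨m, hm⟩ : ∃ m, height v = m + 1 := ⟨height v - 1, by omega⟩
  rw [height_parent, hm, Nat.add_sub_cancel, pow_succ, mul_comm,
    ← Int.ediv_ediv_of_nonneg (by norm_num)]
  rfl

theorem isLayeredRay_Psi : IsLayeredRay Psi ht proj skewer pos where
  toIsLayered := isLayered_Psi
  ht_ray _ := rfl
  pos_ray _ := rfl
  eq_ray := by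
    rintro (i | ⟨n, v, hn, hv, hpos⟩) h
    · rfl
    · exact absurd h hpos.ne'
  adj_ray i := (SimpleGraph.fromRel_adj _ _ _).2 ⟨by simp, Or.inl (Or.inl ⟨i, rfl, rfl⟩)⟩
  pos_proj := by
    rintro (i | ⟨n, v, hn, hv, hpos⟩)
    · rfl
    · simp only [proj, pos_glue, parent_ediv hpos]
      rfl
  pos_le_of_adj := by
    intro p q h
    rcases Psi_adj_cases h with ⟨i, ⟨rfl, rfl⟩ | ⟨rfl, rfl⟩⟩ | ⟨n, hn, u, v, hu, hv, hH, rfl, rfl⟩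
    · simp only [pos]; omega
    · simp only [pos]; omega
    · simp only [pos_glue]
      rcases H3_adj_cases hH with h' | ⟨h1, h2⟩ | ⟨h1, h2⟩
      · have h2 := ((H3_adj_of_height_eq h').1 (Or.inr hH)).2.1
        -- Adding 1 to the index is dominated by adding `2 ^ height v`, which raises the floor by
        -- exactly 1.
        have h3 : u.1.2.2 / 2 ^ height v ≤ (v.1.2.2 + 1 * 2 ^ height v) / 2 ^ height v :=
          Int.ediv_le_ediv (by positivity) (by
            have : (0 : ℤ) < 2 ^ height v := by positivity
            omega)
        rw [Int.add_mul_ediv_right _ _ (by positivity)] at h3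
        rw [h']
        omega
      · rw [← h2, parent_ediv (by omega)]; omega
      · rw [← h2, parent_ediv (by omega)]; omega

theorem index_eq_of_adj (p q : PsiVert) (h : Psi.Adj p q) (hp : 0 < p.ht) (hq : 0 < q.ht) :
    p.index = q.index := by
  rcases p with i | ⟨n, u, hn, hu, hu0⟩
  · exact absurd hp (lt_irrefl 0)
  rcases q with j | ⟨m, v, hm, hv, hv0⟩
  · exact absurd hq (lt_irrefl 0)
  exact (Psi_adj_inner h).1

/-- One crude bound depending only on the meatball serves for both height and position, in the form
required by `exists_tail`. -/
theorem ht_le_and_pos_le (p : PsiVert) (hp : 0 < p.ht) :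
    p.ht ≤ p.index + glueStart p.index + 3 * 2 ^ p.index ∧
      p.pos ≤ p.index + glueStart p.index + 3 * 2 ^ p.index := by
  rcases p with i | ⟨n, v, hn, hv, hv0⟩
  · exact absurd hp (lt_irrefl 0)
  obtain ⟨h1, h2, h3⟩ := hv
  have h4 : v.1.2.2 / 2 ^ height v ≤ 3 * 2 ^ n :=
    Int.ediv_le_of_le_mul (by positivity) h3
  simp only [ht, pos, index]
  change height v ≤ n at h1
  have h5 : (((3 * 2 ^ n : ℕ)) : ℤ) = 3 * 2 ^ n := by push_cast; ring
  rw [← h5] at h4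
  omega

theorem Psi_ray_tail (γ : ℕ → PsiVert) (hγ : IsGeodesicRay Psi γ) :
    ∃ N a, ∀ i, γ (N + i) = skewer (a + i) :=
  isLayeredRay_Psi.exists_tail (B := fun n => n + glueStart n + 3 * 2 ^ n)
    index_eq_of_adj ht_le_and_pos_le hγ

end Souvlaki

theorem lemma3p1 :
    Souvlaki.IsGromovHyperbolic Souvlaki.Psi ∧
    (∀ x : Souvlaki.PsiVert, ∃ γ : ℕ → Souvlaki.PsiVert,
      Souvlaki.IsGeodesicRay Souvlaki.Psi γ ∧ γ 0 = x) ∧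
    (∀ γ γ' : ℕ → Souvlaki.PsiVert,
      Souvlaki.IsGeodesicRay Souvlaki.Psi γ → Souvlaki.IsGeodesicRay Souvlaki.Psi γ' →
      γ 0 = γ' 0 → ∃ N : ℕ, ∀ i : ℕ, N ≤ i → γ i = γ' i) ∧
    (∀ γ : ℕ → Souvlaki.PsiVert, Souvlaki.IsGeodesicRay Souvlaki.Psi γ →
      ∃ N a : ℕ, ∀ i : ℕ, γ (N + i) = Souvlaki.PsiVert.skewer (a + i)) ∧
    Nat.card (Souvlaki.HyperbolicBoundary Souvlaki.Psi) = 1 :=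
  ⟨Souvlaki.isLayeredRay_Psi.isGromovHyperbolic,
    Souvlaki.isLayeredRay_Psi.exists_isGeodesicRay,
    fun γ γ' hγ hγ' h => hγ.eventually_eq_of_tail hγ' h
      (Souvlaki.Psi_ray_tail γ hγ) (Souvlaki.Psi_ray_tail γ' hγ'),
    Souvlaki.Psi_ray_tail,
    Souvlaki.isLayeredRay_Psi.card_hyperbolicBoundary Souvlaki.Psi_ray_tail⟩
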